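/- All graphs are finite, undirected and simple. A neighborhood system $\Sigma$ for a graph $G=(V,E)$ assigns to every vertex $v\in V$ a set $\Sigma(v)$ of neighbors of $v$ in $G$. Let $\rho(\Sigma)=\max_{v\in V}|\Sigma(v)|$ (taken to be $0$ if $V=\emptyset$), and let $\chi(\Sigma)$ be the minimum number of colors in a (not necessarily proper) coloring of $V$ in which any two distinct vertices that appear together in some $\Sigma(v)$ receive different colors. The system $\Sigma$ is non-empty if $\Sigma(v)\neq\emptyset$ for some $v$. A class $\mathcal F$ of graphs is $\sigma$-bounded if there is a function $f:\mathbb N\to\mathbb N$ such that $\chi(\Sigma)\le f(\rho(\Sigma))$ for every $G\in\mathcal F$ and every neighborhood system $\Sigma$ for $G$; it is linearly $\sigma$-bounded if the supremum of $\chi(\Sigma)/\rho(\Sigma)$, over all $G\in\mathcal F$ and all non-empty neighborhood systems $\Sigma$ for $G$, is finite. A star coloring of $G$ is a proper coloring of the vertices of $G$ such that every pair of color classes induces a forest of stars (every component is a star, a single vertex counting as a star); the star chromatic number $\chi_s(G)$ is the least number of colors in a star coloring of $G$. Theorem. Let $\mathcal F$ be a class of graphs. The following four propositions are equivalent: (i)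 $\mathcal F$ is linearly $\sigma$-bounded. (ii) $\mathcal F$ is $\sigma$-bounded. (iii) The supremum of $\chi(\Sigma)$, over all $G\in\mathcal F$ and all neighborhood systems $\Sigma$ for $G$ with $\rho(\Sigma)=2$, is finite. (iv) $\mathcal F$ has bounded star chromatic number, that is, the supremum of $\chi_s(G)$ over all $G\in\mathcal F$ is finite. -/

import Mathlib

open scoped ENNReal

universe u

namespace SigmaColoring

/-- A finite undirected simple graph, bundled with its vertex set. A class of graphs is a
set of such graphs. -/
structure FiniteGraph : Type (u + 1) where
  /-- the vertex set -/
  V : Type u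
  /-- the vertex set is finite -/
  [fintypeV : Fintype V]
  /-- the adjacency structure -/
  graph : SimpleGraph V

attribute [instance] FiniteGraph.fintypeV

/-- A neighborhood system for `G`: a choice, for each vertex `v`, of a subset of the
neighborhood of `v`. -/
structure NeighborhoodSystem {V : Type u} (G : SimpleGraph V) where
  /-- the chosen set of neighbors of a vertex -/
  sets : V → Finset V
  adj : ∀ v, ∀ w ∈ sets v, G.Adj v w

namespace NeighborhoodSystem

variable {V : Type u} {G : SimpleGraph V}

/-- A coloring of the vertices in which any two distinct vertices appearing together in some
set of the system receive different colors. It need not be a proper coloring of `G`. -/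
def IsColoring (S : NeighborhoodSystem G) {α : Type} (c : V → α) : Prop :=
  ∀ w, ∀ x ∈ S.sets w, ∀ y ∈ S.sets w, x ≠ y → c x ≠ c y

/-- The minimum number of colors in a coloring for the system `S`. -/
noncomputable def chi (S : NeighborhoodSystem G) : ℕ∞ :=
  ⨅ n ∈ {n : ℕ | ∃ c : V → Fin n, S.IsColoring c}, (n : ℕ∞)

/-- The maximum size of a set of the system `S`. -/
def rho [Fintype V] (S : NeighborhoodSystem G) : ℕ :=
  Finset.univ.sup fun v => (S.sets v).card

/-- The system is non-empty: at least one of its sets is non-empty. -/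
def Nontrivial (S : NeighborhoodSystem G) : Prop :=
  ∃ v, (S.sets v).Nonempty

end NeighborhoodSystem

/-- A forest of stars: every connected component is a star. A single vertex and a single edge
are stars. -/
def IsStarForest {V : Type u} (G : SimpleGraph V) : Prop :=
  ∀ C : G.ConnectedComponent, ∃ r, C.toSimpleGraph = SimpleGraph.starGraph r

/-- A proper coloring is a star coloring if every pair of color classes induces a forest of
stars. -/
def IsStarColoring {V : Type u} {G : SimpleGraph V} {α : Type} (c : G.Coloring α) : Prop :=
  ∀ i j : α, i ≠ j → IsStarForest (G.induce {v | c v = i ∨ c v = j})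

/-- The star chromatic number: the least number of colors in a star coloring. -/
noncomputable def starChromaticNumber {V : Type u} (G : SimpleGraph V) : ℕ∞ :=
  ⨅ n ∈ {n : ℕ | ∃ c : G.Coloring (Fin n), IsStarColoring c}, (n : ℕ∞)

/-- The class is σ-bounded: for some function `f`, every neighborhood system `S` for a graph of
the class satisfies `χ(S) ≤ f (ρ(S))`. -/
def SigmaBounded (F : Set FiniteGraph.{u}) : Prop :=
  ∃ f : ℕ → ℕ, ∀ G ∈ F, ∀ S : NeighborhoodSystem G.graph, S.chi ≤ (f S.rho : ℕ∞)

/-- The supremum of `χ(S) / ρ(S)` over all non-empty neighborhood systems `S` for graphs of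
the class. -/
noncomputable def sigmaConstant (F : Set FiniteGraph.{u}) : ℝ≥0∞ :=
  ⨆ G ∈ F, ⨆ S : NeighborhoodSystem G.graph, ⨆ _ : S.Nontrivial,
    (S.chi : ℝ≥0∞) / (S.rho : ℝ≥0∞)

/-- The class is linearly σ-bounded. -/
def LinearlySigmaBounded (F : Set FiniteGraph.{u}) : Prop :=
  sigmaConstant F < ⊤

/-- The supremum of `χ(S)` over all neighborhood systems `S` with `ρ(S) = 2` for graphs of the
class. -/
noncomputable def chiSupRhoTwo (F : Set FiniteGraph.{u}) : ℕ∞ :=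
  ⨆ G ∈ F, ⨆ S : NeighborhoodSystem G.graph, ⨆ _ : S.rho = 2, S.chi

/-- The class has bounded star chromatic number. -/
def BoundedStarChromaticNumber (F : Set FiniteGraph.{u}) : Prop :=
  (⨆ G ∈ F, starChromaticNumber G.graph) < ⊤

end SigmaColoring

namespace SigmaColoring

open Finset

/-! A proper coloring is a star coloring exactly when no four-vertex path is two-colored. (iv) ⇒
(i): given such a coloring, a vertex `v` and a color `j`, at most one `w` of color `j` has a set
containing `v` and another vertex of the color of `v`. So conflicts inside color classes have degree
at most `k * ρ`, and a greedy refinement uses linearly many colors (`chi_le_of_noBicoloredPath`).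
(iii) ⇒ (iv): if pair systems need few colors, the graphs have bounded degeneracy. Otherwise some
small `B` has many more vertices with at least `k + 1` neighbors in it, and pairs in these
neighborhoods can be chosen so that no `k`-coloring of `B` separates them all
(`exists_degree_bound`). In a degenerate ordering, a coloring of the system of earlier neighbors
combined with a greedy coloring is a star coloring (`starChromaticNumber_le_of_rank`). -/

theorem biInf_natCast_le_iff {p : ℕ → Prop} {k : ℕ} :
    (⨅ n ∈ {n : ℕ | p n}, (n : ℕ∞)) ≤ k ↔ ∃ n ≤ k, p n := by
  constructor
  · intro h
    by_contra! hc
    have : ((k + 1 : ℕ) : ℕ∞) ≤ ⨅ n ∈ {n : ℕ | p n}, (n : ℕ∞) := by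
      refine le_iInf₂ fun n hn => ?_
      by_contra! hlt
      have hlt' : n < k + 1 := by exact_mod_cast hlt
      exact hc n (by omega) hn
    have h2 : k + 1 ≤ k := by exact_mod_cast this.trans h
    omega
  · rintro ⟨n, hn, hp⟩
    exact (iInf₂_le n hp).trans (by exact_mod_cast hn)

/-! ### Star colorings and two-colored paths -/

/-- No path on four vertices uses only two colors alternately. -/
def NoBicoloredPath {V : Type u} (G : SimpleGraph V) {α : Type} (c : V → α) : Prop :=
  ∀ a b x d, G.Adj a b → G.Adj b x → G.Adj x d → c a = c x → c b = c d → a = x ∨ b = d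

/-- The center of a star lies on each of its edges, but the end edges `ab` and `xd` of the path
share no vertex. -/
theorem IsStarColoring.noBicoloredPath {V : Type u} {G : SimpleGraph V} {α : Type}
    {c : G.Coloring α} (hc : IsStarColoring c) : NoBicoloredPath G c := by
  intro a b x d hab hbx hxd hax hbd
  by_contra! hne
  have hcab : c a ≠ c b := c.valid hab
  let s : Set V := {v | c v = c a ∨ c v = c b}
  let H := G.induce s
  let a' : s := ⟨a, Or.inl rfl⟩
  let b' : s := ⟨b, Or.inr rfl⟩
  let x' : s := ⟨x, Or.inl hax.symm⟩
  let d' : s := ⟨d, Or.inr hbd.symm⟩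
  have h1 : H.Adj a' b' := hab
  have h2 : H.Adj b' x' := hbx
  have h3 : H.Adj x' d' := hxd
  obtain ⟨r, hr⟩ := hc (c a) (c b) hcab (H.connectedComponentMk a')
  have mem : ∀ {u : s}, H.Reachable u a' → u ∈ (H.connectedComponentMk a').supp := fun h =>
    SimpleGraph.ConnectedComponent.sound h
  have mb : H.Reachable b' a' := h1.symm.reachable
  have mx : H.Reachable x' a' := h2.symm.reachable.trans mb
  have md : H.Reachable d' a' := h3.symm.reachable.trans mx
  have key : ∀ {u w : s} (hu : H.Reachable u a') (hw : H.Reachable w a'), H.Adj u w →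
      r.1 = u ∨ r.1 = w := by
    intro u w hu hw huw
    have : (H.connectedComponentMk a').toSimpleGraph.Adj ⟨u, mem hu⟩ ⟨w, mem hw⟩ := huw
    rw [hr, SimpleGraph.starGraph_adj] at this
    rcases this.2 with h | h
    · exact Or.inl (congrArg Subtype.val h).symm
    · exact Or.inr (congrArg Subtype.val h).symm
  have k1 := key (SimpleGraph.Reachable.refl a') mb h1
  have k3 := key mx md h3
  have hval : ∀ {u w : s}, r.1 = u → r.1 = w → u.1 = w.1 := fun h h' => by rw [← h, ← h']
  rcases k1 with k1 | k1 <;> rcases k3 with k3 | k3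
  · exact hne.1 (hval k1 k3)
  · exact hcab ((congrArg c (hval k1 k3)).trans hbd.symm)
  · exact hbx.ne (hval k1 k3)
  · exact hne.2 (hval k1 k3)

theorem NoBicoloredPath.isStarColoring {V : Type u} {G : SimpleGraph V} {α : Type}
    {c : G.Coloring α} (hc : NoBicoloredPath G c) : IsStarColoring c := by
  intro i j hij
  let H := G.induce {v | c v = i ∨ c v = j}
  intro (C : H.ConnectedComponent)
  have hadj : ∀ {u w}, H.Adj u w → G.Adj u.1 w.1 := fun h => h
  have two : ∀ {u w z}, H.Adj u w → H.Adj w z → c u.1 = c z.1 := by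
    intro u w z h1 h2
    have e1 := c.valid (hadj h1)
    have e2 := c.valid (hadj h2)
    rcases u.2 with hu | hu <;> rcases w.2 with hw | hw <;> rcases z.2 with hz | hz <;>
      simp_all
  have path : ∀ {a b x d}, H.Adj a b → H.Adj b x → H.Adj x d → a = x ∨ b = d := by
    intro a b x d h1 h2 h3
    exact (hc _ _ _ _ (hadj h1) (hadj h2) (hadj h3) (two h1 h2) (two h2 h3)).imp
      Subtype.ext Subtype.ext
  -- A vertex with two neighbors serves as center; if the component has none, any of its vertices
  -- does.
  have center : ∃ r ∈ C.supp, ∀ u w, H.Adj r u → H.Adj u w → w = r := by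
    by_cases h : ∃ r ∈ C.supp, ∃ u u', H.Adj r u ∧ H.Adj r u' ∧ u ≠ u'
    · obtain ⟨r, hr, u₁, u₂, h1, h2, hne⟩ := h
      refine ⟨r, hr, fun u w hu hw => ?_⟩
      by_contra hwr
      have aux : ∀ u', H.Adj r u' → u = u' := fun u' hu' =>
        (path hw.symm hu.symm hu').resolve_left hwr
      exact hne ((aux _ h1).symm.trans (aux _ h2))
    · push Not at h
      obtain ⟨r, hr⟩ := C.nonempty_supp
      refine ⟨r, hr, fun u w hu hw => ?_⟩
      have hu' : u ∈ C.supp :=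
        (SimpleGraph.ConnectedComponent.mem_supp_congr_adj C hu).1 hr
      exact h u hu' w r hw hu.symm
  obtain ⟨r, hr, hcl⟩ := center
  have all : ∀ u, H.Reachable r u → u = r ∨ H.Adj r u := by
    intro u hu
    rw [SimpleGraph.reachable_iff_reflTransGen] at hu
    induction hu with
    | refl => exact Or.inl rfl
    | tail _ hbc ih =>
      rcases ih with rfl | ih
      · exact Or.inr hbc
      · exact Or.inl (hcl _ _ ih hbc)
  have all' : ∀ u ∈ C.supp, u = r ∨ H.Adj r u := fun u hu =>
    all u (SimpleGraph.ConnectedComponent.exact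
      ((SimpleGraph.ConnectedComponent.mem_supp_iff _ _).1 hr |>.trans
        ((SimpleGraph.ConnectedComponent.mem_supp_iff _ _).1 hu).symm))
  refine ⟨⟨r, hr⟩, ?_⟩
  ext u w
  have e : C.toSimpleGraph.Adj u w ↔ H.Adj u.1 w.1 := Iff.rfl
  rw [e, SimpleGraph.starGraph_adj]
  constructor
  · intro h
    refine ⟨fun h' => h.ne (congrArg Subtype.val h'), ?_⟩
    rcases all' u.1 u.2 with hu | hu
    · exact Or.inl (Subtype.ext hu)
    · exact Or.inr (Subtype.ext (hcl _ _ hu h))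
  · rintro ⟨hne, h | h⟩
    · subst h
      rcases all' w.1 w.2 with hw | hw
      · exact absurd (Subtype.ext hw.symm) hne
      · exact hw
    · subst h
      rcases all' u.1 u.2 with hw | hw
      · exact absurd (Subtype.ext hw) hne
      · exact hw.symm

/-! ### Colorings of neighborhood systems -/

/-- Greedy coloring along a ranking. -/
theorem exists_coloring_of_rank {V : Type u} [Fintype V] (π : V → ℕ) (P : V → Finset V) (m : ℕ)
    (hlt : ∀ v, ∀ u ∈ P v, π u < π v) (hcard : ∀ v, (P v).card ≤ m) :
    ∃ c : V → Fin (m + 1), ∀ v, ∀ u ∈ P v, c u ≠ c v := by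
  classical
  have main : ∀ n, ∃ c : V → Fin (m + 1), ∀ v, π v < n → ∀ u ∈ P v, c u ≠ c v := by
    intro n
    induction n with
    | zero => exact ⟨fun _ => 0, fun v hv => absurd hv (Nat.not_lt_zero _)⟩
    | succ n ih =>
      obtain ⟨c, hc⟩ := ih
      have hfree : ∀ v, ∃ i, i ∉ (P v).image c := by
        intro v
        by_contra! h
        have h1 : (univ : Finset (Fin (m + 1))).card ≤ ((P v).image c).card :=
          card_le_card fun i _ => h i
        have h2 := card_image_le (s := P v) (f := c)
        have h3 := hcard v
        rw [card_univ, Fintype.card_fin] at h1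
        omega
      choose g hg using hfree
      refine ⟨fun v => if π v = n then g v else c v, fun v hv u hu => ?_⟩
      have huv := hlt v u hu
      have hun : π u ≠ n := by omega
      by_cases hvn : π v = n
      · simp only [hun, hvn, if_true, if_false]
        intro he
        exact hg v (he ▸ mem_image_of_mem c hu)
      · simp only [hun, hvn, if_false]
        exact hc v (by omega) u hu
  obtain ⟨c, hc⟩ := main (univ.sup π + 1)
  exact ⟨c, fun v => hc v (Nat.lt_succ_of_le (le_sup (mem_univ v)))⟩

namespace NeighborhoodSystem

variable {V : Type u} {G : SimpleGraph V}

theorem chi_le_iff (S : NeighborhoodSystem G) {k : ℕ} :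
    S.chi ≤ k ↔ ∃ c : V → Fin k, S.IsColoring c := by
  refine biInf_natCast_le_iff.trans ⟨?_, fun h => ⟨k, le_rfl, h⟩⟩
  rintro ⟨n, hn, c, hc⟩
  exact ⟨fun v => Fin.castLE hn (c v), fun w x hx y hy hxy he =>
    hc w x hx y hy hxy (Fin.castLE_injective hn he)⟩

theorem chi_le_card (S : NeighborhoodSystem G) {α : Type} [Fintype α] (c : V → α)
    (hc : S.IsColoring c) : S.chi ≤ (Fintype.card α : ℕ) :=
  S.chi_le_iff.2 ⟨fun v => Fintype.equivFin α (c v), fun w x hx y hy hxy he =>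
    hc w x hx y hy hxy ((Fintype.equivFin α).injective he)⟩

theorem card_sets_le_rho [Fintype V] (S : NeighborhoodSystem G) (v : V) :
    (S.sets v).card ≤ S.rho :=
  le_sup (f := fun v => (S.sets v).card) (mem_univ v)

theorem chi_le_one_of_rho_le_one [Fintype V] (S : NeighborhoodSystem G) (h : S.rho ≤ 1) :
    S.chi ≤ (1 : ℕ) :=
  S.chi_le_iff.2 ⟨fun _ => 0, fun w x hx y hy hxy =>
    absurd (card_le_one.1 ((S.card_sets_le_rho w).trans h) x hx y hy) hxy⟩

/-- A coloring without bicolored path on four vertices gives a coloring of every neighborhood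
system with a number of colors linear in the size of its sets. -/
theorem chi_le_of_noBicoloredPath [Fintype V] (S : NeighborhoodSystem G) {k : ℕ}
    (c : V → Fin k) (hc : NoBicoloredPath G c) : S.chi ≤ (k * (k * S.rho + 1) : ℕ) := by
  classical
  -- Two solutions `w`, `w'` for the same `v` and `j` would give a two-colored path `u w v w'`.
  -- Hence `T v j` is the only set that can cause a conflict at `v` through color `j`.
  let Q : V → Fin k → V → Prop := fun v j w =>
    c w = j ∧ v ∈ S.sets w ∧ ∃ u ∈ S.sets w, u ≠ v ∧ c u = c v
  let T : V → Fin k → Finset V := fun v j =>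
    if h : ∃ w, Q v j w then S.sets h.choose else ∅
  have hT : ∀ v w, Q v (c w) w → S.sets w ⊆ T v (c w) := by
    intro v w hw
    have h : ∃ w', Q v (c w) w' := ⟨w, hw⟩
    obtain ⟨e, hv, -⟩ := h.choose_spec
    obtain ⟨-, hv', u, hu, huv, hcu⟩ := hw
    have := (hc u w v h.choose (S.adj _ _ hu).symm (S.adj _ _ hv') (S.adj _ _ hv).symm hcu
      e.symm).resolve_left huv
    simp only [T, dif_pos h]
    exact (congrArg S.sets this).le
  let π : V → ℕ := fun v => Fintype.equivFin V v
  let P : V → Finset V := fun v =>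
    univ.filter fun u => π u < π v ∧ c u = c v ∧ ∃ w, u ∈ S.sets w ∧ v ∈ S.sets w
  obtain ⟨g, hg⟩ := exists_coloring_of_rank π P (k * S.rho)
    (fun v u hu => (mem_filter.1 hu).2.1) (by
      intro v
      have hsub : P v ⊆ univ.biUnion (T v) := by
        intro u hu
        obtain ⟨hlt, hcu, w, huw, hvw⟩ := (mem_filter.1 hu).2
        exact mem_biUnion.2 ⟨c w, mem_univ _,
          hT v w ⟨rfl, hvw, u, huw, fun h => by simp [h] at hlt, hcu⟩ huw⟩
      refine (card_le_card hsub).trans ((card_biUnion_le_card_mul _ _ S.rho fun j _ => ?_).trans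
        (by simp))
      by_cases h : ∃ w, Q v j w
      · simpa only [T, dif_pos h] using S.card_sets_le_rho _
      · simp [T, dif_neg h])
  have := S.chi_le_card (fun v => (c v, g v)) (by
    intro w x hx y hy hxy he
    obtain ⟨h1, h2⟩ := Prod.mk.inj he
    have hπ : π x ≠ π y := fun h =>
      hxy ((Fintype.equivFin V).injective (Fin.ext h))
    rcases lt_or_gt_of_ne hπ with h | h
    · exact hg y x (mem_filter.2 ⟨mem_univ _, h, h1, w, hx, hy⟩) h2
    · exact hg x y (mem_filter.2 ⟨mem_univ _, h, h1.symm, w, hy, hx⟩) h2.symm)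
  simpa using this

/-- If the systems whose sets have at most two elements are colored with `k` colors, then systems
with larger sets are colored by splitting their sets into pairs. -/
theorem chi_le_of_pairs [Fintype V] {k : ℕ}
    (hk : ∀ S : NeighborhoodSystem G, S.rho ≤ 2 → S.chi ≤ k) (S : NeighborhoodSystem G) {r : ℕ}
    (hr : S.rho ≤ r) : S.chi ≤ (k ^ (r * r) : ℕ) := by
  classical
  rcases Nat.eq_zero_or_pos r with rfl | hr0
  · simpa using S.chi_le_one_of_rho_le_one (hr.trans zero_le_one)
  have hidx : ∀ v, ∃ f : V → Fin r, Set.InjOn f (S.sets v) := by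
    intro v
    have hcard : (S.sets v).card ≤ r := (S.card_sets_le_rho v).trans hr
    refine ⟨fun y => if hy : y ∈ S.sets v then Fin.castLE hcard ((S.sets v).equivFin ⟨y, hy⟩)
      else ⟨0, hr0⟩, fun y hy z hz h => ?_⟩
    have hy' : y ∈ S.sets v := hy
    have hz' : z ∈ S.sets v := hz
    simp only [dif_pos hy', dif_pos hz'] at h
    simpa using (Fin.castLE_injective hcard h)
  choose f hf using hidx
  -- With each set labelled injectively by `Fin r`, the system `T (i, j)` keeps the labels `i` and
  -- `j`. Every pair inside a set survives in one of these `r * r` systems, so the product of their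
  -- colorings works.
  let T : Fin r × Fin r → NeighborhoodSystem G := fun p =>
    { sets := fun v => (S.sets v).filter fun x => f v x = p.1 ∨ f v x = p.2
      adj := fun v w hw => S.adj v w (mem_filter.1 hw).1 }
  have hT : ∀ p, (T p).rho ≤ 2 := by
    intro p
    refine Finset.sup_le fun v _ => ?_
    have hsub : ((T p).sets v).image (f v) ⊆ {p.1, p.2} := by
      intro i hi
      obtain ⟨x, hx, rfl⟩ := mem_image.1 hi
      simpa using (mem_filter.1 hx).2
    rw [← card_image_of_injOn (f := f v)
      ((hf v).mono (coe_subset.2 (filter_subset _ _)))]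
    exact (card_le_card hsub).trans card_le_two
  choose g hg using fun p => (T p).chi_le_iff.1 (hk _ (hT p))
  have := S.chi_le_card (fun v p => g p v) (by
    intro w x hx y hy hxy he
    exact hg (f w x, f w y) w x (mem_filter.2 ⟨hx, Or.inl rfl⟩) y
      (mem_filter.2 ⟨hy, Or.inr rfl⟩) hxy (congrFun he _))
  simpa using this

end NeighborhoodSystem

/-! ### Degeneracy from colorings of pair systems -/

section Degeneracy

variable {V : Type u}

/-- In a graph of large minimum degree, many vertices have at least `D` neighbors in a common
small set. -/
theorem exists_small_set_of_minDegree (G : SimpleGraph V) [DecidableRel G.Adj] {W : Finset V}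
    (hW : W.Nonempty) {D K : ℕ} (hD : 0 < D) (hK : 0 < K)
    (hdeg : ∀ v ∈ W, D + 4 * D * K ≤ (W.filter (G.Adj v)).card) :
    ∃ A B : Finset V, A.Nonempty ∧ K * B.card ≤ A.card ∧
      ∀ v ∈ A, D ≤ (B.filter (G.Adj v)).card := by
  classical
  let l := 2 * D * K
  have hl : 0 < l := by positivity
  -- Each vertex is credited for up to `D` neighbors in `B`, and each element of `B` costs `l`. A
  -- maximizer is small, by comparison with `∅`, and no further vertex is worth adding.
  let φ : Finset V → ℤ := fun B =>
    ((∑ v ∈ W, min D (B.filter (G.Adj v)).card : ℕ) : ℤ) - l * B.card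
  obtain ⟨B, hBW, hB⟩ := exists_max_image W.powerset φ ⟨∅, empty_mem_powerset W⟩
  rw [mem_powerset] at hBW
  have hsmall : l * B.card ≤ D * W.card := by
    have h0 := hB ∅ (empty_mem_powerset W)
    have h1 : ∑ v ∈ W, min D (B.filter (G.Adj v)).card ≤ W.card * D :=
      sum_le_card_nsmul _ _ _ fun v _ => min_le_left _ _
    simp only [φ, filter_empty, card_empty, Nat.min_zero, sum_const_zero] at h0
    zify at h1 ⊢
    push_cast at h0 h1
    linarith
  let U := W.filter fun v => (B.filter (G.Adj v)).card < D
  have hgain : ∀ w ∈ W \ B, (U.filter fun v => G.Adj v w).card ≤ l := by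
    intro w hw
    obtain ⟨hwW, hwB⟩ := mem_sdiff.1 hw
    have h0 := hB (insert w B) (mem_powerset.2 (insert_subset hwW hBW))
    have h1 : (∑ v ∈ W, min D (B.filter (G.Adj v)).card) + (U.filter fun v => G.Adj v w).card ≤
        ∑ v ∈ W, min D ((insert w B).filter (G.Adj v)).card := by
      rw [filter_filter, card_filter, ← sum_add_distrib]
      refine sum_le_sum fun v _ => ?_
      rw [filter_insert]
      by_cases hvw : G.Adj v w
      · rw [if_pos hvw, card_insert_of_notMem fun h => hwB (mem_filter.1 h).1]
        split_ifs <;> omega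
      · simp [hvw]
    simp only [φ, card_insert_of_notMem hwB] at h0
    zify at h1 ⊢
    push_cast at h0 h1
    linarith
  -- Double counting of edges between `U` and `W \ B`: each unsaturated vertex has at least `2 * l`
  -- neighbors there, while each vertex there has at most `l` in `U`.
  have hU : 2 * U.card ≤ W.card := by
    have h1 : U.card * (2 * l) ≤ ∑ v ∈ U, ((W \ B).filter (G.Adj v)).card := by
      rw [← smul_eq_mul]
      refine card_nsmul_le_sum _ _ _ fun v hv => ?_
      obtain ⟨hvW, hv⟩ := mem_filter.1 hv
      have h2 := hdeg v hvW
      have h3 : (W.filter (G.Adj v)).card ≤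
          ((W \ B).filter (G.Adj v)).card + (B.filter (G.Adj v)).card := by
        rw [← card_union_of_disjoint (disjoint_filter_filter sdiff_disjoint), ← filter_union,
          sdiff_union_of_subset hBW]
      have h4 : 4 * D * K = 2 * l := by simp only [l]; ring
      omega
    have h2 : ∑ v ∈ U, ((W \ B).filter (G.Adj v)).card =
        ∑ w ∈ W \ B, (U.filter fun v => G.Adj v w).card :=
      sum_card_bipartiteAbove_eq_sum_card_bipartiteBelow G.Adj
    have h3 : ∑ w ∈ W \ B, (U.filter fun v => G.Adj v w).card ≤ W.card * l :=
      (sum_le_card_nsmul _ _ _ hgain).trans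
        (Nat.mul_le_mul_right _ (card_le_card sdiff_subset))
    have h4 : (2 * U.card) * l ≤ W.card * l := by
      calc _ = U.card * (2 * l) := by ring
        _ ≤ _ := h1
        _ ≤ _ := h2 ▸ h3
    exact Nat.le_of_mul_le_mul_right h4 hl
  have hsplit : (W.filter fun v => D ≤ (B.filter (G.Adj v)).card).card + U.card = W.card := by
    have := card_filter_add_card_filter_not (s := W) fun v => D ≤ (B.filter (G.Adj v)).card
    simpa only [not_le] using this
  have hWpos := hW.card_pos
  refine ⟨W.filter fun v => D ≤ (B.filter (G.Adj v)).card, B, ?_, ?_,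
    fun v hv => (mem_filter.1 hv).2⟩
  · rw [← card_pos]; omega
  · have h5 : D * (2 * (K * B.card)) ≤ D * W.card := by
      calc _ = l * B.card := by simp only [l]; ring
        _ ≤ _ := hsmall
    have := Nat.le_of_mul_le_mul_left h5 hD
    omega

/-- Among any `k + 1` vertices some pair is monochromatic in a fixed proportion of the given
`k`-colorings. -/
theorem exists_pair_monochromatic {k : ℕ} (hk : 0 < k) (C : Finset (V → Fin k)) {T : Finset V}
    (hT : k + 1 ≤ T.card) :
    ∃ p : V × V, p.1 ∈ T ∧ p.2 ∈ T ∧ p.1 ≠ p.2 ∧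
      C.card ≤ (k + 1) ^ 2 * (C.filter fun c => c p.1 = c p.2).card := by
  classical
  obtain ⟨T', hTT, hcard⟩ := exists_subset_card_eq hT
  rcases C.eq_empty_or_nonempty with rfl | ⟨c₀, hc₀⟩
  · obtain ⟨x, hx, y, hy, hxy⟩ := one_lt_card.1 (show 1 < T.card by omega)
    exact ⟨(x, y), hx, hy, hxy, by simp⟩
  -- Pigeonhole gives each coloring a monochromatic pair in `T'`; averaging over fewer than `(k + 1)
  -- ^ 2` ordered pairs finds a popular one.
  have hmono : ∀ c ∈ C, ∃ p ∈ T'.offDiag, c p.1 = c p.2 := by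
    intro c _
    obtain ⟨x, hx, y, hy, hxy, h⟩ := exists_ne_map_eq_of_card_lt_of_maps_to
      (s := T') (t := (univ : Finset (Fin k))) (f := c) (by simp [hcard])
      (fun _ _ => by simp)
    exact ⟨(x, y), mem_offDiag.2 ⟨hx, hy, hxy⟩, h⟩
  obtain ⟨p₀, hp₀, -⟩ := hmono c₀ hc₀
  let μ : V × V → ℕ := fun p => (C.filter fun c => c p.1 = c p.2).card
  obtain ⟨p, hp, hmax⟩ := exists_max_image T'.offDiag
    μ ⟨p₀, hp₀⟩
  obtain ⟨h1, h2, h3⟩ := mem_offDiag.1 hp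
  refine ⟨p, hTT h1, hTT h2, h3, ?_⟩
  have hcov : C ⊆ T'.offDiag.biUnion fun p : V × V => C.filter fun c => c p.1 = c p.2 := by
    intro c hc
    obtain ⟨p, hp, h⟩ := hmono c hc
    exact mem_biUnion.2 ⟨p, hp, mem_filter.2 ⟨hc, h⟩⟩
  refine (card_le_card hcov).trans ((card_biUnion_le_card_mul _ _ _ hmax).trans ?_)
  refine Nat.mul_le_mul_right _ ?_
  rw [offDiag_card, hcard, sq]
  exact Nat.sub_le _ _

/-- One can choose a pair in every given set so that few colorings separate all the pairs. -/
theorem exists_pairs_few_colorings {k : ℕ} (hk : 0 < k) (C : Finset (V → Fin k))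
    (N : V → Finset V) (A : Finset V) (hN : ∀ v ∈ A, k + 1 ≤ (N v).card) :
    ∃ p : V → V × V, (∀ v ∈ A, (p v).1 ∈ N v ∧ (p v).2 ∈ N v ∧ (p v).1 ≠ (p v).2) ∧
      (C.filter fun c => ∀ v ∈ A, c (p v).1 ≠ c (p v).2).card * ((k + 1) ^ 2) ^ A.card ≤
        ((k + 1) ^ 2 - 1) ^ A.card * C.card := by
  classical
  induction A using Finset.induction_on with
  | empty => exact ⟨fun v => (v, v), by simp, by simp⟩
  | insert a A ha ih =>
    obtain ⟨p, hp, hcard⟩ := ih fun v hv => hN v (mem_insert_of_mem hv)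
    set C' := C.filter fun c => ∀ v ∈ A, c (p v).1 ≠ c (p v).2
    -- The new pair is chosen against the surviving colorings `C'`, so it eliminates a fraction `1 /
    -- (k + 1) ^ 2` of them or more.
    obtain ⟨x, h1, h2, h3, h4⟩ := exists_pair_monochromatic hk C' (hN a (mem_insert_self _ _))
    have hne : ∀ v ∈ A, v ≠ a := fun v hv h => ha (h ▸ hv)
    refine ⟨Function.update p a x, ?_, ?_⟩
    · intro v hv
      rcases mem_insert.1 hv with rfl | hv
      · simpa using ⟨h1, h2, h3⟩
      · simpa [hne v hv] using hp v hv
    · have e : (C.filter fun c => ∀ v ∈ insert a A,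
          c (Function.update p a x v).1 ≠ c (Function.update p a x v).2) =
          C'.filter fun c => ¬ c x.1 = c x.2 := by
        ext c
        simp only [C', mem_filter, forall_mem_insert, Function.update_self]
        have : (∀ v ∈ A, c (Function.update p a x v).1 ≠ c (Function.update p a x v).2) ↔
            ∀ v ∈ A, c (p v).1 ≠ c (p v).2 :=
          forall₂_congr fun v hv => by rw [Function.update_of_ne (hne v hv)]
        rw [this]
        tauto
      rw [e, card_insert_of_notMem ha]
      have h5 := card_filter_add_card_filter_not (s := C') fun c => c x.1 = c x.2
      obtain ⟨q, hq⟩ : ∃ q, (k + 1) ^ 2 = q + 1 := ⟨(k + 1) ^ 2 - 1, by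
        have : 0 < (k + 1) ^ 2 := by positivity
        omega⟩
      rw [hq] at h4 hcard ⊢
      simp only [Nat.add_sub_cancel] at hcard ⊢
      set s := (C'.filter fun c => c x.1 = c x.2).card
      set t := (C'.filter fun c => ¬ c x.1 = c x.2).card
      have h6 : t * (q + 1) ≤ q * C'.card := by nlinarith
      calc t * (q + 1) ^ (A.card + 1) = t * (q + 1) * (q + 1) ^ A.card := by ring
        _ ≤ q * C'.card * (q + 1) ^ A.card := Nat.mul_le_mul_right _ h6
        _ = q * (C'.card * (q + 1) ^ A.card) := by ring
        _ ≤ q * (q ^ A.card * C.card) := Nat.mul_le_mul_left _ hcard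
        _ = q ^ (A.card + 1) * C.card := by ring

/-- With `q + 1 = (k + 1) ^ 2`, this says that `K` pairs per vertex of `B` outweigh its `k` color
choices. -/
theorem exists_mul_pow_lt_pow_succ (k q : ℕ) : ∃ K, 0 < K ∧ k * q ^ K < (q + 1) ^ K := by
  have h0 : (0 : ℝ) ≤ q / (q + 1) := by positivity
  have h1 : (q : ℝ) / (q + 1) < 1 := by
    rw [div_lt_one (by positivity)]; linarith
  obtain ⟨K, hK⟩ := exists_pow_lt_of_lt_one (show (0 : ℝ) < 1 / (k + 1) by positivity) h1
  have hK' : (q : ℝ) ^ K * (k + 1) < (q + 1) ^ K := by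
    rw [div_pow, div_lt_div_iff₀ (by positivity) (by positivity)] at hK
    linarith
  have h2 : q ^ K * (k + 1) < (q + 1) ^ K := by exact_mod_cast hK'
  refine ⟨K + 1, K.succ_pos, ?_⟩
  have h3 : q ^ K * (k + 1) * (q + 1) < (q + 1) ^ K * (q + 1) :=
    Nat.mul_lt_mul_of_pos_right h2 q.succ_pos
  have h4 : k * q ^ (K + 1) ≤ q ^ K * (k + 1) * (q + 1) := by
    calc k * q ^ (K + 1) = q ^ K * k * q := by ring
      _ ≤ _ := by gcongr <;> omega
  rw [pow_succ (q + 1)]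
  omega

/-- If all systems whose sets have at most two elements are colored with `k` colors, then every
subgraph has a vertex of small degree. -/
theorem exists_degree_bound (k : ℕ) (hk : 0 < k) : ∃ d : ℕ, ∀ (V : Type u) [Fintype V]
    (G : SimpleGraph V) [DecidableRel G.Adj],
    (∀ S : NeighborhoodSystem G, S.rho ≤ 2 → S.chi ≤ k) →
      ∀ W : Finset V, W.Nonempty → ∃ v ∈ W, (W.filter (G.Adj v)).card ≤ d := by
  obtain ⟨q, hq⟩ : ∃ q, (k + 1) ^ 2 = q + 1 := ⟨(k + 1) ^ 2 - 1, by
    have : 0 < (k + 1) ^ 2 := by positivity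
    omega⟩
  obtain ⟨K, hK0, hK⟩ := exists_mul_pow_lt_pow_succ k q
  refine ⟨(k + 1) + 4 * (k + 1) * K, fun V _ G _ hS W hW => ?_⟩
  classical
  by_contra! hdeg
  obtain ⟨A, B, hA, hAB, hnb⟩ := exists_small_set_of_minDegree G hW k.succ_pos hK0
    fun v hv => (hdeg v hv).le
  have hB : 0 < B.card := by
    obtain ⟨a, ha⟩ := hA
    have := (hnb a ha).trans (card_filter_le _ _)
    omega
  let i₀ : Fin k := ⟨0, hk⟩
  -- Colors outside `B` are frozen, so only `k ^ B.card` colorings have to be eliminated; all chosen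
  -- pairs lie in `B`.
  let C : Finset (V → Fin k) := Fintype.piFinset fun v => if v ∈ B then univ else {i₀}
  have hC : C.card = k ^ B.card := by
    simp only [C, Fintype.card_piFinset, apply_ite card, card_univ, Fintype.card_fin,
      card_singleton]
    simp
  obtain ⟨p, hp, hcard⟩ := exists_pairs_few_colorings hk C (fun v => B.filter (G.Adj v)) A hnb
  let S : NeighborhoodSystem G :=
    { sets := fun v => if v ∈ A then {(p v).1, (p v).2} else ∅
      adj := by
        intro v w hw
        by_cases hv : v ∈ A
        · obtain ⟨h1, h2, -⟩ := hp v hv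
          rw [if_pos hv, mem_insert, mem_singleton] at hw
          rcases hw with rfl | rfl
          · exact (mem_filter.1 h1).2
          · exact (mem_filter.1 h2).2
        · simp [hv] at hw }
  have hrho : S.rho ≤ 2 := by
    refine Finset.sup_le fun v _ => ?_
    simp only [S]
    split_ifs
    · exact card_le_two
    · simp
  obtain ⟨c, hc⟩ := S.chi_le_iff.1 (hS S hrho)
  have hpos : 0 < (C.filter fun c => ∀ v ∈ A, c (p v).1 ≠ c (p v).2).card := by
    refine card_pos.2 ⟨fun v => if v ∈ B then c v else i₀, mem_filter.2 ⟨?_, fun v hv => ?_⟩⟩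
    · refine Fintype.mem_piFinset.2 fun v => ?_
      split_ifs <;> simp
    · obtain ⟨h1, h2, h3⟩ := hp v hv
      simp only [if_pos (mem_filter.1 h1).1, if_pos (mem_filter.1 h2).1]
      exact hc v _ (by simp [S, hv]) _ (by simp [S, hv]) h3
  rw [hC, hq, Nat.add_sub_cancel] at hcard
  have h1 : (q + 1) ^ A.card ≤ q ^ A.card * k ^ B.card :=
    Nat.le_trans (Nat.le_mul_of_pos_left _ hpos) (by convert hcard)
  obtain ⟨m, hm⟩ := Nat.exists_eq_add_of_le hAB
  have h2 : (k * q ^ K) ^ B.card < ((q + 1) ^ K) ^ B.card := Nat.pow_lt_pow_left hK hB.ne'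
  have h3 : q ^ m ≤ (q + 1) ^ m := Nat.pow_le_pow_left (Nat.le_succ q) m
  have h4 : q ^ A.card * k ^ B.card < (q + 1) ^ A.card := by
    calc q ^ A.card * k ^ B.card = (k * q ^ K) ^ B.card * q ^ m := by
          rw [hm, pow_add, pow_mul, mul_pow]; ring
      _ ≤ (k * q ^ K) ^ B.card * (q + 1) ^ m := Nat.mul_le_mul_left _ h3
      _ < ((q + 1) ^ K) ^ B.card * (q + 1) ^ m :=
          Nat.mul_lt_mul_of_pos_right h2 (by positivity)
      _ = (q + 1) ^ A.card := by rw [hm, pow_add, pow_mul]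
  omega

/-- A ranking of the vertices of a degenerate graph in which every vertex has few predecessors. -/
theorem exists_rank_of_degenerate (G : SimpleGraph V) [DecidableRel G.Adj] {d : ℕ}
    (hG : ∀ W : Finset V, W.Nonempty → ∃ v ∈ W, (W.filter (G.Adj v)).card ≤ d) (W : Finset V) :
    ∃ π : V → ℕ, Set.InjOn π W ∧
      ∀ v ∈ W, (W.filter fun u => G.Adj v u ∧ π u < π v).card ≤ d := by
  classical
  induction W using Finset.strongInduction with
  | H W ih =>
    rcases W.eq_empty_or_nonempty with rfl | hW
    · exact ⟨fun _ => 0, by simp, by simp⟩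
    obtain ⟨v, hv, hvd⟩ := hG W hW
    obtain ⟨π, hinj, hπ⟩ := ih (W.erase v) (erase_ssubset hv)
    -- The low-degree vertex `v` is ranked last, so it adds no predecessor to the others.
    let M := (W.erase v).sup π + 1
    have hM : ∀ u ∈ W, u ≠ v → π u < M := fun u hu huv =>
      Nat.lt_succ_of_le (le_sup (mem_erase.2 ⟨huv, hu⟩))
    refine ⟨Function.update π v M, ?_, ?_⟩
    · intro x hx y hy h
      by_cases hxv : x = v <;> by_cases hyv : y = v
      · rw [hxv, hyv]
      · subst hxv
        rw [Function.update_self, Function.update_of_ne hyv] at h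
        exact absurd h.symm (hM y hy hyv).ne
      · subst hyv
        rw [Function.update_self, Function.update_of_ne hxv] at h
        exact absurd h (hM x hx hxv).ne
      · rw [Function.update_of_ne hyv, Function.update_of_ne hxv] at h
        exact hinj (mem_erase.2 ⟨hxv, hx⟩) (mem_erase.2 ⟨hyv, hy⟩) h
    · intro x hx
      by_cases hxv : x = v
      · subst hxv
        exact (card_le_card (monotone_filter_right _ fun u _ hu => hu.1)).trans hvd
      · refine (card_le_card fun u hu => ?_).trans (hπ x (mem_erase.2 ⟨hxv, hx⟩))
        obtain ⟨huW, huadj, hult⟩ := mem_filter.1 hu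
        rw [Function.update_of_ne hxv] at hult
        have huv : u ≠ v := by
          rintro rfl
          rw [Function.update_self] at hult
          exact absurd hult (hM x hx hxv).not_gt
        rw [Function.update_of_ne huv] at hult
        exact mem_filter.2 ⟨mem_erase.2 ⟨huv, huW⟩, huadj, hult⟩

end Degeneracy

/-! ### Star colorings from degenerate orderings -/

theorem starChromaticNumber_le_iff {V : Type u} {G : SimpleGraph V} {k : ℕ} :
    starChromaticNumber G ≤ k ↔ ∃ n ≤ k, ∃ c : G.Coloring (Fin n), IsStarColoring c :=
  biInf_natCast_le_iff

theorem starChromaticNumber_le_card {V : Type u} {G : SimpleGraph V} {α : Type} [Fintype α]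
    (c : V → α) (hproper : ∀ {u v}, G.Adj u v → c u ≠ c v) (hc : NoBicoloredPath G c) :
    starChromaticNumber G ≤ (Fintype.card α : ℕ) := by
  have hinj := (Fintype.equivFin α).injective
  refine starChromaticNumber_le_iff.2 ⟨_, le_rfl,
    SimpleGraph.Coloring.mk (fun v => Fintype.equivFin α (c v)) fun h he => hproper h (hinj he),
    NoBicoloredPath.isStarColoring ?_⟩
  intro a b x d h1 h2 h3 h4 h5
  exact hc a b x d h1 h2 h3 (hinj h4) (hinj h5)

/-- If every vertex has at most `d` predecessors in a ranking and systems with sets of size at most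
`d` are colored with `m` colors, then the star chromatic number is bounded. -/
theorem starChromaticNumber_le_of_rank {V : Type u} [Fintype V] (G : SimpleGraph V)
    [DecidableRel G.Adj] {d m : ℕ} (π : V → ℕ) (hinj : Function.Injective π)
    (hπ : ∀ v, (univ.filter fun u => G.Adj v u ∧ π u < π v).card ≤ d)
    (hS : ∀ S : NeighborhoodSystem G, S.rho ≤ d → S.chi ≤ m) :
    starChromaticNumber G ≤ ((d + d * d + 1) * m : ℕ) := by
  classical
  let N : V → Finset V := fun v => univ.filter fun u => G.Adj v u ∧ π u < π v
  have hN : ∀ {u v}, u ∈ N v ↔ G.Adj v u ∧ π u < π v := by simp [N]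
  let S : NeighborhoodSystem G := ⟨N, fun v w hw => (hN.1 hw).1⟩
  obtain ⟨g, hg⟩ := S.chi_le_iff.1 (hS S (Finset.sup_le fun v _ => hπ v))
  obtain ⟨f, hf⟩ := exists_coloring_of_rank π (fun v => N v ∪ (N v).biUnion N) (d + d * d)
    (by
      intro v u hu
      rcases mem_union.1 hu with hu | hu
      · exact (hN.1 hu).2
      · obtain ⟨w, hw, hu⟩ := mem_biUnion.1 hu
        exact (hN.1 hu).2.trans (hN.1 hw).2)
    (fun v => (card_union_le _ _).trans (Nat.add_le_add (hπ v)
      ((card_biUnion_le_card_mul _ _ d fun w _ => hπ w).trans (Nat.mul_le_mul_right _ (hπ v)))))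
  have lt_of_adj : ∀ {u v}, G.Adj u v → u ∈ N v ∨ v ∈ N u := by
    intro u v h
    rcases lt_or_gt_of_ne (hinj.ne h.ne) with h' | h'
    · exact Or.inl (hN.2 ⟨h.symm, h'⟩)
    · exact Or.inr (hN.2 ⟨h, h'⟩)
  -- If `a` precedes `b`, then `a` and `x` share the set `N b` and `g` separates them; otherwise `x`
  -- is two steps back from `a` and `f` does.
  have back : ∀ {a b x}, G.Adj a b → x ∈ N b → f a = f x → g a = g x → a = x := by
    intro a b x hab hx hfa hga
    by_contra hne
    rcases lt_of_adj hab with h | h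
    · exact hg b a h x hx hne hga
    · exact hf a x (mem_union_right _ (mem_biUnion.2 ⟨b, h, hx⟩)) hfa.symm
  have := starChromaticNumber_le_card (G := G) (fun v => (f v, g v))
    (by
      intro u v h he
      have he' : f u = f v := (Prod.mk.inj he).1
      rcases lt_of_adj h with h | h
      · exact hf v u (mem_union_left _ h) he'
      · exact hf u v (mem_union_left _ h) he'.symm)
    (by
      intro a b x e hab hbx hxe h1 h2
      obtain ⟨h1, h1'⟩ := Prod.mk.inj h1
      obtain ⟨h2, h2'⟩ := Prod.mk.inj h2
      rcases lt_of_adj hbx with h | h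
      · exact Or.inr (back hxe.symm h h2.symm h2'.symm).symm
      · exact Or.inl (back hab h h1 h1'))
  simpa using this

/-! ### The four implications -/

theorem LinearlySigmaBounded.sigmaBounded {F : Set FiniteGraph.{u}}
    (h : LinearlySigmaBounded F) : SigmaBounded F := by
  obtain ⟨N, hN⟩ := ENNReal.exists_nat_gt h.ne
  -- The `+ 1` covers systems with only empty sets, which the supremum ignores but which may need
  -- one color.
  refine ⟨fun r => N * r + 1, fun G hG S => ?_⟩
  by_cases hS : S.Nontrivial
  · have h1 : (S.chi : ℝ≥0∞) / (S.rho : ℝ≥0∞) ≤ N :=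
      (le_iSup₂_of_le (f := fun (G : FiniteGraph.{u}) (_ : G ∈ F) =>
        ⨆ S : NeighborhoodSystem G.graph, ⨆ _ : S.Nontrivial,
          (S.chi : ℝ≥0∞) / (S.rho : ℝ≥0∞)) G hG
        (le_iSup₂_of_le (f := fun (S : NeighborhoodSystem G.graph) (_ : S.Nontrivial) =>
          (S.chi : ℝ≥0∞) / (S.rho : ℝ≥0∞)) S hS le_rfl)).trans hN.le
    obtain ⟨v, hv⟩ := hS
    have h0 : S.rho ≠ 0 := by
      have := S.card_sets_le_rho v
      have := hv.card_pos
      omega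
    have h2 : (S.chi : ℝ≥0∞) ≤ N * S.rho :=
      (ENNReal.div_le_iff (by exact_mod_cast h0) (ENNReal.natCast_ne_top _)).1 h1
    have h3 : S.chi ≤ (N * S.rho : ℕ) := by
      rw [← ENat.toENNReal_le]
      simpa using h2
    exact h3.trans (by exact_mod_cast Nat.le_succ _)
  · refine (S.chi_le_one_of_rho_le_one (Finset.sup_le fun v _ => ?_)).trans
      (by exact_mod_cast Nat.le_add_left _ _)
    have : S.sets v = ∅ := not_nonempty_iff_eq_empty.1 fun hv => hS ⟨v, hv⟩
    simp [this]

theorem SigmaBounded.chiSupRhoTwo_lt_top {F : Set FiniteGraph.{u}} (h : SigmaBounded F) :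
    chiSupRhoTwo F < ⊤ := by
  obtain ⟨f, hf⟩ := h
  refine lt_of_le_of_lt (b := ((f 2 : ℕ) : ℕ∞)) ?_ (ENat.natCast_lt_top _)
  exact iSup₂_le fun G hG => iSup₂_le fun S hS => hS ▸ hf G hG S

theorem boundedStarChromaticNumber_of_chiSupRhoTwo {F : Set FiniteGraph.{u}}
    (h : chiSupRhoTwo F < ⊤) : BoundedStarChromaticNumber F := by
  classical
  obtain ⟨k, hk⟩ := ENat.ne_top_iff_exists.1 h.ne
  -- The bound `k + 1` also covers `ρ ≤ 1`, where one color suffices even if `k = 0`.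
  have hpairs : ∀ G ∈ F, ∀ S : NeighborhoodSystem G.graph, S.rho ≤ 2 →
      S.chi ≤ (k + 1 : ℕ) := by
    intro G hG S hS
    by_cases h2 : S.rho = 2
    · have h1 : S.chi ≤ k :=
        hk ▸ le_iSup₂_of_le (f := fun (G : FiniteGraph.{u}) (_ : G ∈ F) =>
          ⨆ S : NeighborhoodSystem G.graph, ⨆ _ : S.rho = 2, S.chi) G hG
          (le_iSup₂_of_le S h2 le_rfl)
      exact h1.trans (by exact_mod_cast Nat.le_succ k)
    · exact (S.chi_le_one_of_rho_le_one (by omega)).trans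
        (by exact_mod_cast Nat.le_add_left _ _)
  obtain ⟨d, hd⟩ := exists_degree_bound.{u} (k + 1) k.succ_pos
  refine lt_of_le_of_lt (b := (((d + d * d + 1) * (k + 1) ^ (d * d) : ℕ) : ℕ∞)) ?_
    (ENat.natCast_lt_top _)
  refine iSup₂_le fun G hG => ?_
  obtain ⟨π, hinj, hπ⟩ := exists_rank_of_degenerate G.graph
    (hd G.V G.graph (hpairs G hG)) univ
  exact starChromaticNumber_le_of_rank G.graph π (Set.injOn_univ.1 (by simpa using hinj))
    (fun v => hπ v (mem_univ v)) fun S hS => S.chi_le_of_pairs (hpairs G hG) hS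

theorem BoundedStarChromaticNumber.linearlySigmaBounded {F : Set FiniteGraph.{u}}
    (h : BoundedStarChromaticNumber F) : LinearlySigmaBounded F := by
  obtain ⟨k, hk⟩ := ENat.ne_top_iff_exists.1 h.ne
  refine lt_of_le_of_lt (b := ((k * (k + 1) : ℕ) : ℝ≥0∞)) ?_ (ENNReal.natCast_lt_top _)
  refine iSup₂_le fun G hG => iSup₂_le fun S hS => ?_
  have hG' : starChromaticNumber G.graph ≤ k :=
    hk ▸ le_iSup₂ (f := fun (G : FiniteGraph.{u}) (_ : G ∈ F) => starChromaticNumber G.graph) G hG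
  obtain ⟨n, hn, c, hc⟩ := starChromaticNumber_le_iff.1 hG'
  have h1 := S.chi_le_of_noBicoloredPath c hc.noBicoloredPath
  obtain ⟨v, hv⟩ := hS
  have h0 : 0 < S.rho := hv.card_pos.trans_le (S.card_sets_le_rho v)
  have h2 : n * (n * S.rho + 1) ≤ k * (k + 1) * S.rho := by
    calc n * (n * S.rho + 1) ≤ k * (k * S.rho + S.rho) := by gcongr; exact h0
      _ = _ := by ring
  refine ENNReal.div_le_of_le_mul ?_
  have h3 : S.chi ≤ (k * (k + 1) * S.rho : ℕ) := h1.trans (by exact_mod_cast h2)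
  rw [← ENat.toENNReal_le] at h3
  simpa using h3

end SigmaColoring

theorem theorem1 (F : Set SigmaColoring.FiniteGraph.{u}) :
    List.TFAE
      [SigmaColoring.LinearlySigmaBounded F,
       SigmaColoring.SigmaBounded F,
       SigmaColoring.chiSupRhoTwo F < ⊤,
       SigmaColoring.BoundedStarChromaticNumber F] := by
  tfae_have 1 → 2 := SigmaColoring.LinearlySigmaBounded.sigmaBounded
  tfae_have 2 → 3 := SigmaColoring.SigmaBounded.chiSupRhoTwo_lt_top
  tfae_have 3 → 4 := SigmaColoring.boundedStarChromaticNumber_of_chiSupRhoTwo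
  tfae_have 4 → 1 := SigmaColoring.BoundedStarChromaticNumber.linearlySigmaBounded
  tfae_finish
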